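/- Fix an algebraic signature (a set of function symbols of finite arities) and an infinite set of variables; let $\mathbf{Fm}$ be the absolutely free algebra over these variables (the formulas). All algebras are nonempty algebras in this signature. A \emph{logic} $\mathrm{L}$ is a set of rules $\Gamma \vdash_{\mathrm{L}} \varphi$ with $\Gamma$ a finite set of formulas and $\varphi$ a formula such that: $\Gamma \vdash_{\mathrm{L}} \varphi$ whenever $\varphi \in \Gamma$; if $\Gamma \vdash_{\mathrm{L}} \psi$ and $\Delta, \psi \vdash_{\mathrm{L}} \varphi$, then $\Gamma, \Delta \vdash_{\mathrm{L}} \varphi$; and the set of rules is closed under substitutions. For an arbitrary set of formulas $\Gamma$ we write $\Gamma \vdash_{\mathrm{L}} \varphi$ if $\Gamma_0 \vdash_{\mathrm{L}} \varphi$ for some finite $\Gamma_0 \subseteq \Gamma$, and $\Gamma \vdash_{\mathrm{L}} \Delta$ if $\Gamma \vdash_{\mathrm{L}} \delta$ for each $\delta \in \Delta$. An \emph{$\mathrm{L}$-filter} on an algebra $\mathbf{A}$ is a set $F \subseteq A$ such that for each valid rule $\Gamma \vdash_{\mathrm{L}} \varphi$ and each homomorphism $h \colon \mathbf{Fm} \to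 \mathbf{A}$, $h[\Gamma] \subseteq F$ implies $h(\varphi) \in F$; $\mathrm{Fg}^{\mathbf{A}}_{\mathrm{L}}(a_1, \dots, a_n)$ denotes the smallest $\mathrm{L}$-filter on $\mathbf{A}$ containing $a_1, \dots, a_n$ (where $n = 0$ is allowed). A congruence $\theta$ of $\mathbf{A}$ is \emph{compatible} with $F \subseteq A$ if $a \in F$ and $\langle a, b\rangle \in \theta$ imply $b \in F$. The largest congruence compatible with $F$ is denoted by $\Omega^{\mathbf{A}} F$. The class $\mathsf{Alg}\,\mathrm{L}$ consists of the algebras on which the identity is the only congruence compatible with all $\mathrm{L}$-filters. The logic $\mathrm{L}$ is \emph{algebraizable} if (a) for each algebra $\mathbf{A}$ the map $F \mapsto \Omega^{\mathbf{A}} F$ is monotone and injective on the $\mathrm{L}$-filters of $\mathbf{A}$, and (b) there is a set of formulas $\Delta(x, y)$ in two variables such that for each algebra $\mathbf{A}$, each $\mathrm{L}$-filter $F$ on $\mathbf{A}$ and all $a, b \in A$: $\langle a, b \rangle \in \Omega^{\mathbf{A}} F$ if and only if $\Delta(a, b) \subseteq F$. The logic $\mathrm{L}$ has the \emph{global deduction--detachment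 theorem (DDT)} if there is a (possibly infinite) set of formulas $I(x, y)$ in two distinct variables such that for each set of formulas $\Gamma$ and all formulas $\varphi, \psi$ $$\Gamma, \varphi \vdash_{\mathrm{L}} \psi \iff \Gamma \vdash_{\mathrm{L}} I(\varphi, \psi).$$ It has the \emph{global equational definability of compact filters (EDCF)} if for each $n \in \omega$ there is a (possibly infinite) set of equations $\mathbf{\Theta}_n(x_1, \dots, x_n, y)$ such that for each $\mathbf{A} \in \mathsf{Alg}\,\mathrm{L}$ and all $a_1, \dots, a_n, b \in A$ $$b \in \mathrm{Fg}^{\mathbf{A}}_{\mathrm{L}}(a_1, \dots, a_n) \iff \mathbf{A} \vDash \mathbf{\Theta}_n(a_1, \dots, a_n, b).$$ \textbf{Corollary.} An algebraizable logic has the global DDT if and only if it has the global EDCF. -/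

import Mathlib

universe u v

/-- A finitary propositional logic over an algebraic signature `S` (a first-order language that is
meant to have no relation symbols) and a set `V` of variables. Formulas are the elements
`S.Term V` of the absolutely free algebra over `V`. A logic is a set of finitary rules
`Γ ⊢ φ`, closed under the three conditions below. -/
structure PropLogic (S : FirstOrder.Language.{u, 0}) (V : Type v) where
  /-- The rule with premises `Γ` and conclusion `φ` is valid. -/
  Valid : Finset (S.Term V) → S.Term V → Prop
  valid_of_mem : ∀ (Γ : Finset (S.Term V)) (φ : S.Term V), φ ∈ Γ → Valid Γ φ
  cut : open scoped Classical in
    ∀ (Γ Δ : Finset (S.Term V)) (ψ φ : S.Term V),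
      Valid Γ ψ → Valid (insert ψ Δ) φ → Valid (Γ ∪ Δ) φ
  structural : open scoped Classical in
    ∀ (σ : V → S.Term V) (Γ : Finset (S.Term V)) (φ : S.Term V),
      Valid Γ φ → Valid (Γ.image fun γ => γ.subst σ) (φ.subst σ)

/-- Congruences of an algebra. -/
def IsCongruence (S : FirstOrder.Language.{u, 0}) {A : Type*} [S.Structure A] (θ : Setoid A) : Prop :=
  ∀ (n : ℕ) (f : S.Functions n) (x y : Fin n → A),
    (∀ i, θ (x i) (y i)) → θ (FirstOrder.Language.Structure.funMap f x) (FirstOrder.Language.Structure.funMap f y)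

/-- The equivalence relation `θ` is compatible with the subset `F`. -/
def IsCompatible {A : Type*} (θ : Setoid A) (F : Set A) : Prop :=
  ∀ a b : A, a ∈ F → θ a b → b ∈ F

/-- The Leibniz congruence of `F`: the largest congruence compatible with `F`
(see `leibniz_isGreatest`). -/
def leibniz (S : FirstOrder.Language.{u, 0}) {A : Type*} [S.Structure A] (F : Set A) : Setoid A :=
  sSup {θ : Setoid A | IsCongruence S θ ∧ IsCompatible θ F}

theorem leibniz_isGreatest (S : FirstOrder.Language.{u, 0}) {A : Type*} [S.Structure A] (F : Set A) :
    IsGreatest {θ : Setoid A | IsCongruence S θ ∧ IsCompatible θ F} (leibniz S F) := by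
  classical
  refine ⟨⟨?_, ?_⟩, fun θ hθ => le_sSup hθ⟩
  · intro n f x y hxy
    have step : ∀ (i : Fin n) (z : Fin n → A) (a b : A), leibniz S F a b →
        leibniz S F (FirstOrder.Language.Structure.funMap f (Function.update z i a))
          (FirstOrder.Language.Structure.funMap f (Function.update z i b)) := by
      intro i z a b hab
      unfold leibniz at hab
      rw [Setoid.sSup_eq_eqvGen] at hab
      change Relation.EqvGen _ a b at hab
      induction hab with
      | rel a b h =>
        obtain ⟨θ, hθ, hab⟩ := h
        have hle : θ ≤ leibniz S F := le_sSup hθ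
        refine hle (hθ.1 n f _ _ fun j => ?_)
        by_cases hj : j = i
        · subst hj; simpa using hab
        · simp [Function.update_of_ne hj]
      | refl a => exact (leibniz S F).refl _
      | symm a b _ ih => exact (leibniz S F).symm ih
      | trans a b c _ _ ih₁ ih₂ => exact (leibniz S F).trans ih₁ ih₂
    have key : ∀ s : Finset (Fin n), leibniz S F (FirstOrder.Language.Structure.funMap f x)
        (FirstOrder.Language.Structure.funMap f (s.piecewise y x)) := by
      intro s
      induction s using Finset.induction_on with
      | empty => simp
      | insert i s hi ih =>
        refine (leibniz S F).trans ih ?_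
        have h := step i (s.piecewise y x) (x i) (y i) (hxy i)
        rw [← Finset.piecewise_insert] at h
        have h' : Function.update (s.piecewise y x) i (x i) = s.piecewise y x := by
          rw [Function.update_eq_self_iff]
          simp [hi]
        rwa [h'] at h
    simpa using key Finset.univ
  · intro a b ha hab
    unfold leibniz at hab
    rw [Setoid.sSup_eq_eqvGen] at hab
    change Relation.EqvGen _ a b at hab
    have : a ∈ F ↔ b ∈ F := by
      clear ha
      induction hab with
      | rel a b h =>
        obtain ⟨θ, hθ, hab⟩ := h
        exact ⟨fun h => hθ.2 a b h hab, fun h => hθ.2 b a h (θ.symm hab)⟩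
      | refl a => exact Iff.rfl
      | symm a b _ ih => exact ih.symm
      | trans a b c _ _ ih₁ ih₂ => exact ih₁.trans ih₂
    exact this.1 ha

namespace PropLogic

variable {S : FirstOrder.Language.{u, 0}} {V : Type v}

/-- Consequence from an arbitrary set of premises (the logic is finitary). -/
def Derives (L : PropLogic S V) (Γ : Set (S.Term V)) (φ : S.Term V) : Prop :=
  ∃ Γ₀ : Finset (S.Term V), (Γ₀ : Set (S.Term V)) ⊆ Γ ∧ L.Valid Γ₀ φ

/-- `F` is an `L`-filter on the algebra `A`: every valid rule of `L` is valid in the matrix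
`⟨A, F⟩`. Homomorphisms from the absolutely free algebra `S.Term V` to `A` are exactly the maps
`fun t => t.realize h` for `h : V → A`. -/
def IsFilter (L : PropLogic S V) {A : Type*} [S.Structure A] (F : Set A) : Prop :=
  ∀ (Γ : Finset (S.Term V)) (φ : S.Term V), L.Valid Γ φ →
    ∀ h : V → A, (∀ γ ∈ Γ, γ.realize h ∈ F) → φ.realize h ∈ F

/-- The `L`-filter generated by `X`. -/
def filterGen (L : PropLogic S V) {A : Type*} [S.Structure A] (X : Set A) : Set A :=
  ⋂₀ {F : Set A | L.IsFilter F ∧ X ⊆ F}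

theorem filterGen_isLeast (L : PropLogic S V) {A : Type*} [S.Structure A] (X : Set A) :
    IsLeast {F : Set A | L.IsFilter F ∧ X ⊆ F} (L.filterGen X) :=
  ⟨⟨fun Γ φ hΓ h hγ F hF => hF.1 Γ φ hΓ h fun γ hm => hγ γ hm F hF,
    fun _ hx _ hF => hF.2 hx⟩, fun _ hF _ hx => hx _ hF⟩

/-- `A` belongs to the algebraic counterpart `Alg L`: the only congruence of the (nonempty)
algebra `A` that is compatible with all `L`-filters on `A` is the identity. -/
def Alg (L : PropLogic S V) (A : Type (max u v)) [S.Structure A] : Prop :=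
  Nonempty A ∧ ∀ θ : Setoid A, IsCongruence S θ →
    (∀ F : Set A, L.IsFilter F → IsCompatible θ F) → θ = ⊥

/-- The Leibniz operator is monotone on the `L`-filters of each algebra. -/
def IsProtoalgebraic (L : PropLogic S V) : Prop :=
  ∀ (A : Type (max u v)) [S.Structure A] [Nonempty A] (F G : Set A),
    L.IsFilter F → L.IsFilter G → F ⊆ G → leibniz S F ≤ leibniz S G

/-- Protoalgebraic, and the Leibniz operator is injective on the `L`-filters of each algebra. -/
def IsWeaklyAlgebraizable (L : PropLogic S V) : Prop :=
  L.IsProtoalgebraic ∧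
    ∀ (A : Type (max u v)) [S.Structure A] [Nonempty A] (F G : Set A),
      L.IsFilter F → L.IsFilter G → leibniz S F = leibniz S G → F = G

/-- There is a (possibly infinite) set `Δ(x, y)` of congruence formulas without parameters; the
variables `x`, `y` are `0`, `1`. -/
def IsEquivalential (L : PropLogic S V) : Prop :=
  ∃ Δ : Set (S.Term (Fin 2)),
    ∀ (A : Type (max u v)) [S.Structure A] [Nonempty A] (F : Set A), L.IsFilter F →
      ∀ a b : A, leibniz S F a b ↔ ∀ δ ∈ Δ, δ.realize ![a, b] ∈ F

/-- Algebraizable logics. -/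
def IsAlgebraizable (L : PropLogic S V) : Prop :=
  L.IsWeaklyAlgebraizable ∧ L.IsEquivalential

/-- The global deduction--detachment theorem, with a (possibly infinite) set `I(x, y)` of formulas;
the variables `x`, `y` are `0`, `1`. -/
def HasGlobalDDT (L : PropLogic S V) : Prop :=
  ∃ I : Set (S.Term (Fin 2)), ∀ (Γ : Set (S.Term V)) (φ ψ : S.Term V),
    L.Derives (insert φ Γ) ψ ↔ ∀ χ ∈ I, L.Derives Γ (χ.subst ![φ, ψ])

/-- The set `Θ` of equations in the variables `x₁, …, xₙ` (the elements of `Fin n`) and `y` (the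
element of `Unit`) is a global equational definition of `n`-generated `L`-filters on the class `K`
of algebras. -/
def IsGlobalEqDef (L : PropLogic S V) (K : (A : Type (max u v)) → [S.Structure A] → Prop)
    (n : ℕ) (Θ : Set (S.Term (Fin n ⊕ Unit) × S.Term (Fin n ⊕ Unit))) : Prop :=
  ∀ (A : Type (max u v)) [S.Structure A], K A → ∀ (a : Fin n → A) (b : A),
    b ∈ L.filterGen (Set.range a) ↔
      ∀ e ∈ Θ, e.1.realize (Sum.elim a fun _ => b) = e.2.realize (Sum.elim a fun _ => b)

/-- `L` has the global equational definability of compact filters (EDCF) on `K`. -/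
def HasGlobalEDCFOn (L : PropLogic S V)
    (K : (A : Type (max u v)) → [S.Structure A] → Prop) : Prop :=
  ∃ Θ : (n : ℕ) → Set (S.Term (Fin n ⊕ Unit) × S.Term (Fin n ⊕ Unit)),
    ∀ n : ℕ, L.IsGlobalEqDef K n (Θ n)

/-- `L` has the global EDCF (on its algebraic counterpart). -/
def HasGlobalEDCF (L : PropLogic S V) : Prop :=
  L.HasGlobalEDCFOn fun A [S.Structure A] => L.Alg A

end PropLogic

/-! The DDT set `I` also works on filters of every algebra: `b` lies in the filter generated by `X`
and `a` iff `I(a, b)` lies in the one generated by `X`. Iterating, membership in an `n`-generated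
filter becomes membership of certain terms in the least filter. Algebraizability gives equations `τ`
such that `a ∈ F` iff `τ(a)` holds modulo `Ω F`. On an algebra in `Alg L` the least filter has
trivial Leibniz congruence, so these become genuine equations.

Conversely, let `T` be the theory of `Γ`. The quotient of the formula algebra by `Ω T` is in `Alg
L`, and every filter on it contains the image of `T`. Hence `Γ, φ ⊢ ψ` iff the class of `ψ` is in
the filter generated by the class of `φ`, iff `Θ₁(φ, ψ)` holds modulo `Ω T`, iff `Δ(Θ₁(φ, ψ)) ⊆ T`.
So `I` is `Δ` applied to `Θ₁`; only `n = 1` is needed. -/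

namespace PropLogic

open FirstOrder FirstOrder.Language

variable {S : FirstOrder.Language.{u, 0}} {V : Type v}

/-- The absolutely free algebra. -/
abbrev termStructure (S : FirstOrder.Language.{u, 0}) [S.IsAlgebraic] (W : Type*) :
    S.Structure (S.Term W) where
  funMap f x := Term.func f x
  RelMap r := isEmptyElim r

attribute [local instance] termStructure

/-! ### Term algebras and quotient algebras -/

section Algebra

variable [S.IsAlgebraic]

theorem realize_var {W : Type*} (t : S.Term W) : t.realize Term.var = t := by
  induction t with
  | var => rfl
  | func f ts ih => exact congrArg (Term.func f) (funext ih)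

theorem realize_eq_subst {W W' : Type*} (h : W → S.Term W') (t : S.Term W) :
    t.realize h = t.subst h := by
  induction t with
  | var => rfl
  | func f ts ih => exact congrArg (Term.func f) (funext ih)

/-- The quotient of an algebra by a congruence. -/
noncomputable abbrev quotientStructure {A : Type*} [S.Structure A] (θ : Setoid A) :
    S.Structure (Quotient θ) where
  funMap f x := Quotient.mk θ (Structure.funMap f fun i => (x i).out)
  RelMap r := isEmptyElim r

theorem realize_quotient {A : Type*} [S.Structure A] {θ : Setoid A} (hθ : IsCongruence S θ)
    {W : Type*} (h : W → A) (t : S.Term W) :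
    letI := quotientStructure (S := S) θ
    t.realize (fun w => Quotient.mk θ (h w)) = Quotient.mk θ (t.realize h) := by
  let _ := quotientStructure (S := S) θ
  induction t with
  | var => rfl
  | func f ts ih =>
    refine Quotient.sound (hθ _ f _ _ fun i => ?_)
    simp only [ih i]
    exact Quotient.mk_out _

end Algebra

/-! ### Generated filters and theories -/

section Filters

variable {L : PropLogic S V}

theorem IsCompatible.of_le {A : Type*} {θ η : Setoid A} {F : Set A} (hθη : θ ≤ η)
    (hη : IsCompatible η F) : IsCompatible θ F :=
  fun a b ha hab => hη a b ha (hθη hab)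

theorem isFilter_filterGen {A : Type*} [S.Structure A] (X : Set A) :
    L.IsFilter (L.filterGen X) :=
  (L.filterGen_isLeast X).1.1

theorem subset_filterGen {A : Type*} [S.Structure A] (X : Set A) : X ⊆ L.filterGen X :=
  (L.filterGen_isLeast X).1.2

theorem filterGen_subset {A : Type*} [S.Structure A] {X F : Set A} (hF : L.IsFilter F)
    (hX : X ⊆ F) : L.filterGen X ⊆ F :=
  (L.filterGen_isLeast X).2 ⟨hF, hX⟩

theorem filterGen_mono {A : Type*} [S.Structure A] {X Y : Set A} (h : X ⊆ Y) :
    L.filterGen X ⊆ L.filterGen Y :=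
  filterGen_subset (isFilter_filterGen Y) (h.trans (subset_filterGen Y))

theorem IsFilter.inter {A : Type*} [S.Structure A] {F G : Set A} (hF : L.IsFilter F)
    (hG : L.IsFilter G) : L.IsFilter (F ∩ G) :=
  fun Γ φ hΓ h hγ =>
    ⟨hF Γ φ hΓ h fun γ hm => (hγ γ hm).1, hG Γ φ hΓ h fun γ hm => (hγ γ hm).2⟩

theorem IsFilter.realize_mem {A : Type*} [S.Structure A] {F : Set A} (hF : L.IsFilter F)
    {Γ : Set (S.Term V)} {φ : S.Term V} (hφ : L.Derives Γ φ) (h : V → A)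
    (hΓ : ∀ γ ∈ Γ, γ.realize h ∈ F) : φ.realize h ∈ F := by
  obtain ⟨Γ₀, hsub, hv⟩ := hφ
  exact hF Γ₀ φ hv h fun γ hγ => hΓ γ (hsub hγ)

theorem IsFilter.preimage_realize [S.IsAlgebraic] {A : Type*} [S.Structure A] {F : Set A}
    (hF : L.IsFilter F) {W : Type*} (g : W → A) :
    L.IsFilter {t : S.Term W | t.realize g ∈ F} := by
  intro Γ φ hΓ h hγ
  simp only [Set.mem_ofPred_eq, realize_eq_subst, Term.realize_subst] at hγ ⊢
  exact hF Γ φ hΓ _ hγ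

theorem Derives.of_mem {Γ : Set (S.Term V)} {φ : S.Term V} (h : φ ∈ Γ) : L.Derives Γ φ :=
  ⟨{φ}, by simpa using h, L.valid_of_mem _ _ (by simp)⟩

/-- Iterated cut: the premises from `Δ` are removed one at a time. Each cut changes the premise set,
so `Λ` stays general in the induction. -/
theorem derives_of_valid_union {Γ : Set (S.Term V)} (Δ : Finset (S.Term V)) :
    ∀ (Λ : Finset (S.Term V)) {φ : S.Term V}, (Λ : Set (S.Term V)) ⊆ Γ ∪ Δ →
      L.Valid Λ φ → (∀ δ ∈ Δ, L.Derives Γ δ) → L.Derives Γ φ := by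
  classical
  induction Δ using Finset.induction_on with
  | empty => exact fun Λ φ hsub hv _ => ⟨Λ, by simpa using hsub, hv⟩
  | insert δ Δ _ ih =>
    intro Λ φ hsub hv hΔ
    by_cases hδ : δ ∈ Λ
    · obtain ⟨Γ₀, hΓ₀, hvδ⟩ := hΔ δ (by simp)
      have hcut : L.Valid (Γ₀ ∪ Λ.erase δ) φ := by
        have := L.cut Γ₀ (Λ.erase δ) δ φ hvδ (by convert hv; exact Finset.insert_erase hδ)
        convert this
      refine ih _ ?_ hcut fun ε hε => hΔ ε (by simp [hε])
      intro x hx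
      simp only [Finset.coe_union, Finset.coe_erase, Set.mem_union, Set.mem_sdiff,
        Finset.mem_coe, Set.mem_singleton_iff] at hx
      rcases hx with hx | ⟨hx, hne⟩
      · exact Or.inl (hΓ₀ hx)
      · have := hsub hx
        simpa [hne] using this
    · refine ih Λ (fun x hx => ?_) hv fun ε hε => hΔ ε (by simp [hε])
      have hne : x ≠ δ := fun h => hδ (h ▸ hx)
      have := hsub hx
      simpa [hne] using this

theorem Derives.trans {Γ Δ : Set (S.Term V)} {φ : S.Term V} (hφ : L.Derives Δ φ)
    (h : ∀ δ ∈ Δ, L.Derives Γ δ) : L.Derives Γ φ := by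
  obtain ⟨Δ₀, hsub, hv⟩ := hφ
  exact derives_of_valid_union Δ₀ Δ₀ Set.subset_union_right hv fun δ hδ => h δ (hsub hδ)

/-- The theories of `L` are its filters on the formula algebra. -/
theorem isFilter_derives [S.IsAlgebraic] (Γ : Set (S.Term V)) :
    L.IsFilter {φ : S.Term V | L.Derives Γ φ} := by
  classical
  intro Δ φ hΔ h hδ
  simp only [Set.mem_ofPred_eq, realize_eq_subst] at hδ ⊢
  refine Derives.trans (Δ := ↑(Δ.image fun γ => γ.subst h))
    ⟨_, subset_rfl, ?_⟩ (by simpa using hδ)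
  convert L.structural h Δ φ hΔ

theorem mem_filterGen_iff_derives [S.IsAlgebraic] {Γ : Set (S.Term V)} {φ : S.Term V} :
    φ ∈ L.filterGen Γ ↔ L.Derives Γ φ := by
  refine ⟨fun h => filterGen_subset (isFilter_derives Γ) (fun _ hγ => Derives.of_mem hγ) h,
    fun h => ?_⟩
  have := (isFilter_filterGen (L := L) Γ).realize_mem h Term.var fun γ hγ => by
    rw [realize_var]
    exact subset_filterGen Γ hγ
  rwa [realize_var] at this

end Filters

/-! ### Filters on quotients by Leibniz congruences -/

section Quotient

variable [S.IsAlgebraic] {L : PropLogic S V}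

theorem IsFilter.preimage_mk {A : Type*} [S.Structure A] {θ : Setoid A} (hθ : IsCongruence S θ)
    {G : Set (Quotient θ)}
    (hG : letI := quotientStructure (S := S) θ; L.IsFilter G) :
    L.IsFilter (Quotient.mk θ ⁻¹' G) := by
  let _ := quotientStructure (S := S) θ
  intro Γ φ hΓ h hγ
  have := hG Γ φ hΓ (fun w => Quotient.mk θ (h w)) fun γ hm => by
    rw [realize_quotient hθ]; exact hγ γ hm
  rwa [realize_quotient hθ] at this

theorem IsFilter.quotient {A : Type*} [S.Structure A] {θ : Setoid A} (hθ : IsCongruence S θ)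
    {G : Set (Quotient θ)} (hG : L.IsFilter (Quotient.mk θ ⁻¹' G)) :
    letI := quotientStructure (S := S) θ
    L.IsFilter G := by
  let _ := quotientStructure (S := S) θ
  intro Γ φ hΓ h hγ
  obtain ⟨h, rfl⟩ : ∃ h' : V → A, h = fun w => Quotient.mk θ (h' w) :=
    ⟨fun w => (h w).out, funext fun w => (Quotient.out_eq _).symm⟩
  rw [realize_quotient hθ]
  exact hG Γ φ hΓ h fun γ hm => by
    have := hγ γ hm
    rwa [realize_quotient hθ] at this

theorem isCongruence_comap_mk {A : Type*} [S.Structure A] {θ : Setoid A}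
    (hθ : IsCongruence S θ) {η : Setoid (Quotient θ)}
    (hη : letI := quotientStructure (S := S) θ; IsCongruence S η) :
    IsCongruence S (η.comap (Quotient.mk θ)) := by
  let _ := quotientStructure (S := S) θ
  have key : ∀ (n : ℕ) (f : S.Functions n) (x : Fin n → A),
      Structure.funMap f (fun i => Quotient.mk θ (x i)) =
        Quotient.mk θ (Structure.funMap f x) := fun n f x =>
    realize_quotient hθ x (Term.func f Term.var)
  intro n f x y hxy
  have := hη n f _ _ hxy
  rwa [key, key] at this

variable {A : Type (max u v)} [S.Structure A] [Nonempty A]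

/-- A congruence compatible with all filters is compatible with the image of `F`; its pullback is
then compatible with `F`, hence below `Ω F`. -/
theorem alg_quotient_leibniz {F : Set A} (hF : L.IsFilter F) :
    letI := quotientStructure (S := S) (leibniz S F)
    L.Alg (Quotient (leibniz S F)) := by
  let _ := quotientStructure (S := S) (leibniz S F)
  obtain ⟨hcong, hcomp⟩ := (leibniz_isGreatest S F).1
  have hpre : Quotient.mk (leibniz S F) ⁻¹' (Quotient.mk (leibniz S F) '' F) = F := by
    ext a
    refine ⟨?_, fun ha => ⟨a, ha, rfl⟩⟩
    rintro ⟨b, hb, hba⟩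
    exact hcomp b a hb (Quotient.exact hba)
  refine ⟨‹Nonempty A›.map (Quotient.mk _), fun η hη hηF => le_antisymm ?_ bot_le⟩
  have hle : η.comap (Quotient.mk _) ≤ leibniz S F := by
    refine (leibniz_isGreatest S F).2 ⟨isCongruence_comap_mk hcong hη, fun a b ha hab => ?_⟩
    rw [← hpre]
    exact hηF _ (IsFilter.quotient hcong (hpre.symm ▸ hF)) _ _ ⟨a, ha, rfl⟩ hab
  intro p q
  induction p using Quotient.inductionOn
  induction q using Quotient.inductionOn
  exact fun hpq => Quotient.sound (hle hpq)

/-- In a weakly algebraizable logic, every filter on `A/ΩF` contains `F/ΩF`. -/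
theorem IsWeaklyAlgebraizable.subset_preimage_mk (hL : L.IsWeaklyAlgebraizable) {F : Set A}
    (hF : L.IsFilter F) {G : Set (Quotient (leibniz S F))}
    (hG : letI := quotientStructure (S := S) (leibniz S F); L.IsFilter G) :
    F ⊆ Quotient.mk _ ⁻¹' G := by
  obtain ⟨hcong, hcomp⟩ := (leibniz_isGreatest S F).1
  have hG' := IsFilter.preimage_mk hcong hG
  -- With monotonicity this gives equal Leibniz congruences, so injectivity forces the intersection
  -- to be `F`.
  have hle : leibniz S F ≤ leibniz S (F ∩ Quotient.mk _ ⁻¹' G) := by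
    refine (leibniz_isGreatest S _).2 ⟨hcong, fun a b ha hab => ⟨hcomp a b ha.1 hab, ?_⟩⟩
    have : Quotient.mk (leibniz S F) a = Quotient.mk _ b := Quotient.sound hab
    exact Set.mem_preimage.2 (this ▸ Set.mem_preimage.1 ha.2)
  have heq := hL.2 A _ _ (hF.inter hG') hF
    (le_antisymm (hL.1 A _ _ (hF.inter hG') hF Set.inter_subset_left) hle)
  exact Set.inter_eq_left.1 heq

/-- By monotonicity `Ω F` is compatible with every filter above `F`, so such filters descend to the
quotient; conversely every filter on the quotient pulls back to one above `F`. -/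
theorem IsWeaklyAlgebraizable.mk_mem_filterGen_iff (hL : L.IsWeaklyAlgebraizable) {F : Set A}
    (hF : L.IsFilter F) (X : Set A) (b : A) :
    letI := quotientStructure (S := S) (leibniz S F)
    Quotient.mk (leibniz S F) b ∈ L.filterGen (Quotient.mk (leibniz S F) '' X) ↔
      b ∈ L.filterGen (F ∪ X) := by
  let _ := quotientStructure (S := S) (leibniz S F)
  have hcong := (leibniz_isGreatest S F).1.1
  have hFX := isFilter_filterGen (L := L) (F ∪ X)
  have hcomp : IsCompatible (leibniz S F) (L.filterGen (F ∪ X)) :=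
    IsCompatible.of_le (hL.1 A _ _ hF hFX (Set.subset_union_left.trans (subset_filterGen _)))
      (leibniz_isGreatest S _).1.2
  have hpre : Quotient.mk (leibniz S F) ⁻¹' (Quotient.mk _ '' L.filterGen (F ∪ X)) =
      L.filterGen (F ∪ X) := by
    ext a
    refine ⟨?_, fun ha => ⟨a, ha, rfl⟩⟩
    rintro ⟨c, hc, hca⟩
    exact hcomp c a hc (Quotient.exact hca)
  constructor
  · intro hb
    rw [← hpre]
    exact filterGen_subset (IsFilter.quotient hcong (hpre.symm ▸ hFX))
      (Set.image_mono (Set.subset_union_right.trans (subset_filterGen _))) hb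
  · intro hb
    have hG := isFilter_filterGen (L := L) (Quotient.mk (leibniz S F) '' X)
    refine filterGen_subset (IsFilter.preimage_mk hcong hG)
      (Set.union_subset (hL.subset_preimage_mk hF hG) ?_) hb
    exact Set.image_subset_iff.1 (subset_filterGen _)

end Quotient

/-! ### Transfer and iteration of the deduction theorem -/

section Deduction

variable {L : PropLogic S V}

theorem vecCons_realize {A W : Type*} [S.Structure A] (h : W → A) (s t : S.Term W) :
    (fun i => ((![s, t] : Fin 2 → S.Term W) i).realize h) = ![s.realize h, t.realize h] := by
  funext i
  fin_cases i <;> rfl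

theorem realize_subst_pair {A W : Type*} [S.Structure A] (h : W → A) (s t : S.Term W)
    (χ : S.Term (Fin 2)) :
    (χ.subst ![s, t]).realize h = χ.realize ![s.realize h, t.realize h] := by
  rw [Term.realize_subst, vecCons_realize]

/-- The set `I` witnesses the global deduction--detachment theorem. -/
def IsDDTSet (L : PropLogic S V) (I : Set (S.Term (Fin 2))) : Prop :=
  ∀ (Γ : Set (S.Term V)) (φ ψ : S.Term V),
    L.Derives (insert φ Γ) ψ ↔ ∀ χ ∈ I, L.Derives Γ (χ.subst ![φ, ψ])

variable [Infinite V] {I : Set (S.Term (Fin 2))}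

/-- If `Γ ⊢ φ`, then detachment and deduction give `I(x, Γ) ⊢ I(x, φ)` for a variable `x`. -/
theorem IsDDTSet.isFilter (hI : L.IsDDTSet I) {A : Type*} [S.Structure A] {F : Set A}
    (hF : L.IsFilter F) (a : A) : L.IsFilter {b : A | ∀ χ ∈ I, χ.realize ![a, b] ∈ F} := by
  classical
  intro Γ φ hΓ h hγ χ hχ
  -- A variable fresh for the rule can be sent to `a` without changing the values of its formulas.
  obtain ⟨x, hx⟩ := Infinite.exists_notMem_finset
    (Γ.biUnion (fun γ => γ.varFinset) ∪ φ.varFinset)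
  simp only [Finset.mem_union, Finset.mem_biUnion, not_or, not_exists, not_and] at hx
  have hreal : ∀ t : S.Term V, x ∉ t.varFinset →
      t.realize (Function.update h x a) = t.realize h := by
    intro t ht
    induction t with
    | var y =>
      have : y ≠ x := by rintro rfl; simp at ht
      simp [this]
    | func f ts ih =>
      simp only [Term.varFinset, Finset.mem_biUnion, Finset.mem_univ, true_and, not_exists] at ht
      simp only [Term.realize]
      exact congrArg _ (funext fun i => ih i (ht i))
  set Δ : Set (S.Term V) := {t | ∃ γ ∈ Γ, ∃ χ ∈ I, t = χ.subst ![Term.var x, γ]} with hΔ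
  have hder : L.Derives Δ (χ.subst ![Term.var x, φ]) := by
    refine (hI Δ (Term.var x) φ).1 ?_ χ hχ
    refine Derives.trans (Δ := ↑Γ) ⟨Γ, subset_rfl, hΓ⟩ fun γ hγΓ => ?_
    exact (hI Δ (Term.var x) γ).2 fun χ' hχ' => Derives.of_mem ⟨γ, hγΓ, χ', hχ', rfl⟩
  have := hF.realize_mem hder (Function.update h x a) (by
    rintro _ ⟨γ, hγΓ, χ', hχ', rfl⟩
    rw [realize_subst_pair, hreal γ (hx.1 γ hγΓ)]
    simpa using hγ γ hγΓ χ' hχ')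
  rw [realize_subst_pair, hreal φ hx.2] at this
  simpa using this

/-- The deduction--detachment theorem transfers to filters on arbitrary algebras. -/
theorem IsDDTSet.mem_filterGen_insert_iff (hI : L.IsDDTSet I) {A : Type*} [S.Structure A]
    (X : Set A) (a b : A) :
    b ∈ L.filterGen (insert a X) ↔ ∀ χ ∈ I, χ.realize ![a, b] ∈ L.filterGen X := by
  classical
  obtain ⟨x, y, hxy⟩ := exists_pair_ne V
  have hF := isFilter_filterGen (L := L) X
  constructor
  -- This filter contains `a` since `⊢ I(x, x)`, and `X` since `y ⊢ I(x, y)`.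
  · refine fun hb => filterGen_subset (hI.isFilter hF a)
      (Set.insert_subset (fun χ hχ => ?_) fun c hc χ hχ => ?_) hb
    · have hder := (hI ∅ (Term.var x) (Term.var x)).1 (Derives.of_mem (by simp)) χ hχ
      have := hF.realize_mem hder (fun _ => a) (by simp)
      rwa [realize_subst_pair] at this
    · have hder := (hI {Term.var y} (Term.var x) (Term.var y)).1 (Derives.of_mem (by simp)) χ hχ
      have := hF.realize_mem hder (Function.update (fun _ => c) x a) (by
        rintro _ rfl
        simpa [hxy.symm] using subset_filterGen X hc)
      rw [realize_subst_pair] at this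
      simpa [hxy.symm] using this
  · intro hb
    set Δ : Set (S.Term V) := {t | ∃ χ ∈ I, t = χ.subst ![Term.var x, Term.var y]}
    have hder : L.Derives (insert (Term.var x) Δ) (Term.var y) :=
      (hI Δ _ _).2 fun χ hχ => Derives.of_mem ⟨χ, hχ, rfl⟩
    have := (isFilter_filterGen (L := L) (insert a X)).realize_mem hder
      (Function.update (fun _ => b) x a) (by
        rintro _ (rfl | ⟨χ, hχ, rfl⟩)
        · simpa using subset_filterGen (L := L) (insert a X) (Set.mem_insert a X)
        · rw [realize_subst_pair]
          simpa [hxy.symm] using filterGen_mono (Set.subset_insert a X) (hb χ hχ))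
    simpa [hxy.symm] using this

/-- The generators are discharged one by one. The arbitrary `X` lets the induction hypothesis absorb
the generator `a 0`. -/
theorem IsDDTSet.exists_iterate (hI : L.IsDDTSet I) (n : ℕ) :
    ∃ J : Set (S.Term (Fin n ⊕ Unit)), ∀ (A : Type (max u v)) [S.Structure A] (X : Set A)
      (a : Fin n → A) (b : A), b ∈ L.filterGen (X ∪ Set.range a) ↔
        ∀ t ∈ J, t.realize (Sum.elim a fun _ => b) ∈ L.filterGen X := by
  induction n with
  | zero =>
    refine ⟨{Term.var (Sum.inr ())}, fun A _ X a b => ?_⟩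
    simp [Set.range_eq_empty]
  | succ n ih =>
    obtain ⟨J, hJ⟩ := ih
    refine ⟨{s | ∃ t ∈ J, ∃ χ ∈ I, s = χ.subst
      ![Term.var (Sum.inl 0), t.relabel (Sum.map Fin.succ id)]}, fun A _ X a b => ?_⟩
    have hrange : X ∪ Set.range a = insert (a 0) X ∪ Set.range (Fin.tail a) := by
      rw [← Fin.cons_self_tail a, Fin.range_cons, Fin.tail_cons, Fin.cons_zero]
      simp [Set.insert_union]
    have helim : (Sum.elim a fun _ => b) ∘ Sum.map Fin.succ id =
        Sum.elim (Fin.tail a) fun _ : Unit => b := by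
      funext i
      rcases i with i | i <;> rfl
    rw [hrange, hJ]
    constructor
    · rintro h _ ⟨t, ht, χ, hχ, rfl⟩
      rw [realize_subst_pair, Term.realize_relabel, helim]
      exact (hI.mem_filterGen_insert_iff X _ _).1 (h t ht) χ hχ
    · intro h t ht
      refine (hI.mem_filterGen_insert_iff X _ _).2 fun χ hχ => ?_
      have := h _ ⟨t, ht, χ, hχ, rfl⟩
      rwa [realize_subst_pair, Term.realize_relabel, helim] at this

end Deduction

/-! ### Defining equations -/

section Equations

variable [S.IsAlgebraic] {L : PropLogic S V}

/-- In an algebraizable logic the filters are defined by equations in one variable, up to their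
Leibniz congruences. -/
theorem IsAlgebraizable.exists_defining_equations (hL : L.IsAlgebraizable) :
    ∃ τ : Set (S.Term PUnit.{v + 1} × S.Term PUnit.{v + 1}),
      ∀ (A : Type (max u v)) [S.Structure A] (F : Set A), L.IsFilter F → ∀ a : A,
        a ∈ F ↔ ∀ e ∈ τ, leibniz S F (e.1.realize fun _ => a) (e.2.realize fun _ => a) := by
  obtain ⟨⟨hmono, hinj⟩, Δ, hΔ⟩ := hL
  -- The universe of `PUnit` places the one-generated free algebra in `Type (max u v)`, where the
  -- hypotheses apply.
  let x : S.Term PUnit.{v + 1} := Term.var PUnit.unit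
  have : Nonempty (S.Term PUnit.{v + 1}) := ⟨x⟩
  let G : Set (S.Term PUnit.{v + 1}) := L.filterGen {x}
  have hG : L.IsFilter G := isFilter_filterGen _
  let D : Set (S.Term PUnit.{v + 1}) :=
    {t | ∃ p q, leibniz S G p q ∧ ∃ δ ∈ Δ, t = δ.realize ![p, q]}
  have hDG : D ⊆ G := by
    rintro _ ⟨p, q, hpq, δ, hδ, rfl⟩
    exact (hΔ _ G hG p q).1 hpq δ hδ
  have hH : L.IsFilter (L.filterGen D) := isFilter_filterGen _
  have hHG : L.filterGen D ⊆ G := filterGen_subset hG hDG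
  -- `D` encodes `Ω G` through `Δ`, so the filter it generates has the same Leibniz congruence as
  -- `G`. Thus `x` and `Δ(Ω G)` generate the same filter, and `Ω G` serves as the set of equations.
  have heq : L.filterGen D = G := by
    refine hinj _ _ _ hH hG (le_antisymm (hmono _ _ _ hH hG hHG) fun {p q} hpq => ?_)
    exact (hΔ _ _ hH p q).2 fun δ hδ => subset_filterGen D ⟨p, q, hpq, δ, hδ, rfl⟩
  have hxG : x ∈ G := subset_filterGen _ rfl
  refine ⟨{e | leibniz S G e.1 e.2}, fun A _ F hF a => ?_⟩
  have : Nonempty A := ⟨a⟩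
  have hpre := hF.preimage_realize fun _ : PUnit.{v + 1} => a
  have hδ_realize : ∀ (δ : S.Term (Fin 2)) (p q : S.Term PUnit.{v + 1}),
      (δ.realize ![p, q]).realize (fun _ => a) =
        δ.realize ![p.realize fun _ => a, q.realize fun _ => a] := fun δ p q => by
    rw [realize_eq_subst, realize_subst_pair]
  constructor
  · intro ha e he
    refine (hΔ A F hF _ _).2 fun δ hδ => ?_
    rw [← hδ_realize]
    exact filterGen_subset hpre (Set.singleton_subset_iff.2 ha)
      ((hΔ _ G hG _ _).1 he δ hδ)
  · intro h
    have hsub : L.filterGen D ⊆ _ := filterGen_subset hpre (by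
      rintro _ ⟨p, q, hpq, δ, hδ, rfl⟩
      change Term.realize _ _ ∈ F
      rw [hδ_realize]
      exact (hΔ A F hF _ _).1 (h (p, q) hpq) δ hδ)
    exact hsub (heq ▸ hxG)

omit [S.IsAlgebraic] in
theorem IsProtoalgebraic.leibniz_filterGen_empty (hL : L.IsProtoalgebraic)
    {A : Type (max u v)} [S.Structure A] (hA : L.Alg A) :
    leibniz S (L.filterGen (∅ : Set A)) = ⊥ := by
  have := hA.1
  refine hA.2 _ (leibniz_isGreatest S _).1.1 fun F hF => ?_
  exact IsCompatible.of_le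
    (hL A _ _ (isFilter_filterGen _) hF (filterGen_subset hF (Set.empty_subset F)))
    (leibniz_isGreatest S F).1.2

end Equations

/-! ### The two implications -/

theorem IsAlgebraizable.hasGlobalEDCF [S.IsAlgebraic] [Infinite V] {L : PropLogic S V}
    (hL : L.IsAlgebraizable) (hD : L.HasGlobalDDT) : L.HasGlobalEDCF := by
  obtain ⟨I, hI⟩ := hD
  replace hI : L.IsDDTSet I := hI
  obtain ⟨τ, hτ⟩ := hL.exists_defining_equations
  choose J hJ using hI.exists_iterate
  refine ⟨fun n => {e | ∃ t ∈ J n, ∃ p ∈ τ,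
    e = (p.1.subst fun _ => t, p.2.subst fun _ => t)}, fun n A _ hA a b => ?_⟩
  have h := hJ n A ∅ a b
  rw [Set.empty_union] at h
  have hbot : ∀ p q : A, leibniz S (L.filterGen (∅ : Set A)) p q ↔ p = q := fun p q => by
    rw [hL.1.1.leibniz_filterGen_empty hA]; rfl
  simp only [h, hτ A _ (isFilter_filterGen _), hbot]
  constructor
  · rintro h _ ⟨t, ht, p, hp, rfl⟩
    simpa only [Term.realize_subst] using h t ht p hp
  · intro h t ht p hp
    simpa only [Term.realize_subst] using h _ ⟨t, ht, p, hp, rfl⟩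

theorem IsAlgebraizable.hasGlobalDDT [S.IsAlgebraic] [Infinite V] {L : PropLogic S V}
    (hL : L.IsAlgebraizable) (hE : L.HasGlobalEDCF) : L.HasGlobalDDT := by
  obtain ⟨Θ, hΘ⟩ := hE
  obtain ⟨hW, Δ, hΔ⟩ := hL
  let r : Fin 1 ⊕ Unit → S.Term (Fin 2) := Sum.elim (fun _ => Term.var 0) fun _ => Term.var 1
  refine ⟨{χ | ∃ e ∈ Θ 1, ∃ δ ∈ Δ, χ = δ.subst ![e.1.subst r, e.2.subst r]}, fun Γ φ ψ => ?_⟩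
  have : Nonempty (S.Term V) := ⟨Term.var (Classical.arbitrary V)⟩
  let T : Set (S.Term V) := L.filterGen Γ
  have hT : L.IsFilter T := isFilter_filterGen Γ
  have hcong := (leibniz_isGreatest S T).1.1
  let _ := quotientStructure (S := S) (leibniz S T)
  have hunion : L.filterGen (T ∪ {φ}) = L.filterGen (insert φ Γ) := by
    refine Set.Subset.antisymm (filterGen_subset (isFilter_filterGen _) (Set.union_subset
      (filterGen_mono (Set.subset_insert φ Γ)) ?_)) (filterGen_mono ?_)
    · exact Set.singleton_subset_iff.2 (subset_filterGen _ (Set.mem_insert φ Γ))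
    · exact Set.insert_subset (Or.inr rfl) ((subset_filterGen Γ).trans Set.subset_union_left)
  have hedcf := hΘ 1 _ (alg_quotient_leibniz hT) (fun _ => Quotient.mk (leibniz S T) φ)
    (Quotient.mk _ ψ)
  rw [Set.range_const, ← Set.image_singleton, hW.mk_mem_filterGen_iff hT, hunion,
    mem_filterGen_iff_derives] at hedcf
  have hr : ∀ t : S.Term (Fin 1 ⊕ Unit),
      (t.subst r).subst ![φ, ψ] = t.realize (Sum.elim (fun _ => φ) fun _ => ψ) := by
    intro t
    rw [← realize_eq_subst, Term.realize_subst]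
    congr 1
    funext i
    rcases i with i | i <;> rfl
  have hmk : ∀ t : S.Term (Fin 1 ⊕ Unit),
      t.realize (Sum.elim (fun _ => Quotient.mk (leibniz S T) φ) fun _ => Quotient.mk _ ψ) =
        Quotient.mk (leibniz S T) (t.realize (Sum.elim (fun _ => φ) fun _ => ψ)) := by
    intro t
    rw [← realize_quotient hcong]
    congr 1
    funext i
    rcases i with i | i <;> rfl
  have hδ : ∀ (δ : S.Term (Fin 2)) (e : S.Term (Fin 1 ⊕ Unit) × S.Term (Fin 1 ⊕ Unit)),
      (δ.subst ![e.1.subst r, e.2.subst r]).subst ![φ, ψ] =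
        δ.realize ![e.1.realize (Sum.elim (fun _ => φ) fun _ => ψ),
          e.2.realize (Sum.elim (fun _ => φ) fun _ => ψ)] := by
    intro δ e
    rw [← realize_eq_subst, realize_subst_pair, realize_eq_subst _ (e.1.subst r),
      realize_eq_subst _ (e.2.subst r), hr, hr]
  rw [hedcf]
  -- Equality of classes is `Ω T`-congruence, which `Δ` turns into membership in `T`.
  simp only [hmk, Quotient.eq, hΔ _ T hT]
  constructor
  · rintro h _ ⟨e, he, δ, hδΔ, rfl⟩
    rw [← mem_filterGen_iff_derives, hδ]
    exact h e he δ hδΔ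
  · intro h e he δ hδΔ
    rw [← hδ]
    exact mem_filterGen_iff_derives.2 (h _ ⟨e, he, δ, hδΔ, rfl⟩)

end PropLogic

theorem corollary6 {S : FirstOrder.Language.{u, 0}} [S.IsAlgebraic] {V : Type v} [Infinite V]
    (L : PropLogic S V) (hL : L.IsAlgebraizable) :
    L.HasGlobalDDT ↔ L.HasGlobalEDCF :=
  ⟨hL.hasGlobalEDCF, hL.hasGlobalDDT⟩
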